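/- Let $B$ be a separable real Banach space and let $X$ and $Y$ be Borel measurable $B$-valued random variables such that $\mathbb{E}\|X\|^k<\infty$ and $\mathbb{E}\|Y\|^k<\infty$ for every integer $k\ge 1$. Suppose that $\|X\|$ satisfies the Carleman condition $$\sum_{n=1}^{\infty}\bigl(\mathbb{E}\|X\|^{2n}\bigr)^{-1/(2n)}=\infty ,$$ where $0^{-1/(2n)}=\infty$. For $k\ge1$, let $B^{\hat\otimes k}$ be the $k$-fold projective tensor power of $B$, i.e. the completion of the algebraic tensor power $B^{\otimes k}$ in the norm $\|u\|_\pi=\inf\bigl\{\sum_j\|x_{1j}\|\cdots\|x_{kj}\| : u=\sum_j x_{1j}\otimes\cdots\otimes x_{kj}\bigr\}$ (finite sums), and let $B^{\check\otimes k}$ be the $k$-fold injective tensor power of $B$, i.e. the closure of the linear span of the elementary tensors $x_1\otimes\cdots\otimes x_k:(x_1^*,\dots,x_k^*)\mapsto x_1^*(x_1)\cdots x_k^*(x_k)$ in the Banach space of bounded $k$-linear forms on $(B^*)^k$. Then for every $k\ge1$ the projective moments $\mathbb{E}X^{\hat\otimes k},\mathbb{E}Y^{\hat\otimes k}\in B^{\hat\otimes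 k}$ and the injective moments $\mathbb{E}X^{\check\otimes k},\mathbb{E}Y^{\check\otimes k}\in B^{\check\otimes k}$, i.e. the expectations of the $k$-fold tensor powers $X\otimes\cdots\otimes X$ and $Y\otimes\cdots\otimes Y$ in these two spaces, exist as Bochner integrals, and the following are equivalent: 1. $X$ and $Y$ are equal in distribution. 2. $\mathbb{E}X^{\hat\otimes k}=\mathbb{E}Y^{\hat\otimes k}$ for every $k\ge1$. 3. $\mathbb{E}X^{\check\otimes k}=\mathbb{E}Y^{\check\otimes k}$ for every $k\ge1$. 4. $\langle x^*,X\rangle$ and $\langle x^*,Y\rangle$ are equal in distribution for every $x^*\in B^*$. -/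

import Mathlib

open MeasureTheory ProbabilityTheory
open scoped TensorProduct ENNReal

noncomputable section

/-- The `k`-fold projective tensor power of `B`: the completion of the algebraic tensor power.
The norm that Mathlib puts on `⨂[ℝ] _ : Fin k, B` is the projective one, that is, the infimum of
`∑ j, |c j| * ∏ i, ‖x j i‖` over all representations `u = ∑ j, c j • ⨂ₜ i, x j i`. -/
abbrev ProjTensorPower (k : ℕ) (B : Type*) [NormedAddCommGroup B] [NormedSpace ℝ B] : Type _ :=
  UniformSpace.Completion (⨂[ℝ] _ : Fin k, B)

/-- The tensor power `x ⊗ ⋯ ⊗ x` (`k` factors), as an element of the projective tensor power. -/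
def projPow {B : Type*} [NormedAddCommGroup B] [NormedSpace ℝ B] (k : ℕ) (x : B) :
    ProjTensorPower k B :=
  ((⨂ₜ[ℝ] _ : Fin k, x : ⨂[ℝ] _ : Fin k, B) : UniformSpace.Completion (⨂[ℝ] _ : Fin k, B))

/-- The space of bounded real `k`-linear forms on `E ^ k`, with its operator norm. -/
abbrev MultiForm (k : ℕ) (E : Type*) [NormedAddCommGroup E] [NormedSpace ℝ E] : Type _ :=
  ContinuousMultilinearMap ℝ (fun _ : Fin k => E) ℝ

/-- The elementary tensor `x 0 ⊗ ⋯ ⊗ x (k - 1)` as a bounded `k`-linear form on the dual of `B`: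
it maps `(φ 0, …, φ (k - 1))` to `∏ i, φ i (x i)`. -/
def elemForm {B : Type*} [NormedAddCommGroup B] [NormedSpace ℝ B] (k : ℕ) (x : Fin k → B) :
    MultiForm k (StrongDual ℝ B) :=
  (ContinuousMultilinearMap.mkPiAlgebra ℝ (Fin k) ℝ).compContinuousLinearMap
    (fun i => NormedSpace.inclusionInDoubleDual ℝ B (x i))

theorem elemForm_apply {B : Type*} [NormedAddCommGroup B] [NormedSpace ℝ B] (k : ℕ)
    (x : Fin k → B) (φ : Fin k → StrongDual ℝ B) :
    elemForm k x φ = ∏ i, φ i (x i) := by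
  simp [elemForm]

/-- The closure of the linear span of the elementary tensors in the Banach space of bounded
`k`-linear forms on the dual of `B`. -/
def injSubmodule (k : ℕ) (B : Type*) [NormedAddCommGroup B] [NormedSpace ℝ B] :
    Submodule ℝ (MultiForm k (StrongDual ℝ B)) :=
  (Submodule.span ℝ (Set.range (elemForm (B := B) k))).topologicalClosure

/-- The `k`-fold injective tensor power of `B`: the closed linear span of the elementary tensors
among the bounded `k`-linear forms on the dual of `B`, with the induced norm
`‖u‖ = sup {|u (φ 0, …, φ (k - 1))| : ‖φ i‖ ≤ 1}`. -/
def InjTensorPower (k : ℕ) (B : Type*) [NormedAddCommGroup B] [NormedSpace ℝ B] : Type _ :=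
  injSubmodule k B

instance (k : ℕ) (B : Type*) [NormedAddCommGroup B] [NormedSpace ℝ B] :
    NormedAddCommGroup (InjTensorPower k B) :=
  Submodule.normedAddCommGroup (injSubmodule k B)

instance (k : ℕ) (B : Type*) [NormedAddCommGroup B] [NormedSpace ℝ B] :
    NormedSpace ℝ (InjTensorPower k B) :=
  Submodule.normedSpace (injSubmodule k B)

instance (k : ℕ) (B : Type*) [NormedAddCommGroup B] [NormedSpace ℝ B] :
    CompleteSpace (InjTensorPower k B) :=
  (Submodule.isClosed_topologicalClosure
    (Submodule.span ℝ (Set.range (elemForm (B := B) k)))).completeSpace_coe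

/-- The tensor power `x ⊗ ⋯ ⊗ x` (`k` factors), as an element of the injective tensor power. -/
def injPow {B : Type*} [NormedAddCommGroup B] [NormedSpace ℝ B] (k : ℕ) (x : B) :
    InjTensorPower k B :=
  (⟨elemForm k (fun _ => x),
    Submodule.le_topologicalClosure _ (Submodule.subset_span (Set.mem_range_self _))⟩ :
    injSubmodule k B)

/-- The projective `k`-th moment, a Bochner integral in the projective tensor power. -/
def projMoment {Ω B : Type*} [MeasurableSpace Ω] [NormedAddCommGroup B] [NormedSpace ℝ B]
    (k : ℕ) (X : Ω → B) (μ : Measure Ω) : ProjTensorPower k B :=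
  ∫ ω, projPow k (X ω) ∂μ

/-- The injective `k`-th moment, a Bochner integral in the injective tensor power. -/
def injMoment {Ω B : Type*} [MeasurableSpace Ω] [NormedAddCommGroup B] [NormedSpace ℝ B]
    (k : ℕ) (X : Ω → B) (μ : Measure Ω) : InjTensorPower k B :=
  ∫ ω, injPow k (X ω) ∂μ

/-- The Carleman condition `∑_{n ≥ 1} (E |Z|^(2n))^(-1/(2n)) = ∞` for a real random variable `Z`
(the summation index is shifted by one). The terms are taken in `[0, ∞]`, where a negative power
of `0` is `∞`; so `Z = 0` a.s. satisfies the condition. -/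
def CarlemanCondition {Ω : Type*} [MeasurableSpace Ω] (Z : Ω → ℝ) (μ : Measure Ω) : Prop :=
  ∑' n : ℕ, (∫⁻ ω, ENNReal.ofReal (|Z ω| ^ (2 * (n + 1))) ∂μ) ^ (-(1 / (2 * ((n : ℝ) + 1)))) = ∞

end

/-!
Equality in law gives equality of both kinds of tensor moments, because `x ↦ x ⊗ ⋯ ⊗ x` is
continuous, with norm at most `‖x‖ ^ k`, into either tensor power. Conversely, the bounded
functional `φ ⊗ ⋯ ⊗ φ` (`projDualPow`, `injDualPow`) turns equal tensor moments into equal moments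
of the real random variables `φ ∘ X` and `φ ∘ Y`. As `|φ X| ≤ ‖φ‖ ‖X‖`, Carleman's condition passes
from `‖X‖` to `φ ∘ X`, and so the laws of `φ ∘ X` and `φ ∘ Y` agree by Carleman's uniqueness theorem
for the Hamburger moment problem (`measure_eq_of_carleman`). The laws of all `φ ∘ X` determine the
characteristic functional of `X`, hence the law of `X`.

Carleman's theorem is deduced from quasi-analyticity. All derivatives at `0` of the difference `h`
of the two characteristic functions vanish, and the `n`-th derivative of `h` is bounded by the
`n`-th absolute moment `M n` of the sum of the two laws, a log-convex sequence. Bang's argument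
(`norm_iterate_le_of_step`) shows that the smallest `B` with `‖h⁽ʲ⁾(t)‖ ≤ B * e ^ j * M j` for all
`j` can rise from `e ^ (-(N + 1))` to `e ^ (-N)` only over a distance at least
`M N / (e * M (N + 1))`. When `∑ M n / M (n + 1)` diverges, the total distance needed to rise from
`0` is infinite, so that `h = 0` (`eq_zero_of_quasiAnalytic`). Carleman's inequality
(`summable_geom_mean`) for the ratios `M n / M (n + 1)`, whose products telescope, yields this
divergence from that of the series of roots in Carleman's condition.
-/

open MeasureTheory ProbabilityTheory
open scoped TensorProduct ENNReal

/-! ### Quasi-analyticity -/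

theorem ratio_monotone_of_logConvex {M : ℕ → ℝ} (hpos : ∀ n, 0 < M n)
    (hconv : ∀ n, M (n + 1) ^ 2 ≤ M n * M (n + 2)) :
    Monotone fun n => M (n + 1) / M n := by
  refine monotone_nat_of_le_succ fun n => ?_
  rw [div_le_div_iff₀ (hpos _) (hpos _)]
  nlinarith [hconv n]

/-- Bang's step. If every derivative satisfies `‖F j x‖ ≤ e ^ (j - (N + 1)) * M j` at a point `x`,
then a move to the right by at most `M N / (e * M (N + 1))` costs no more than one factor `e`. -/
theorem norm_iterate_le_of_step {E : Type*} [NormedAddCommGroup E] [NormedSpace ℝ E]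
    {F : ℕ → ℝ → E} {M : ℕ → ℝ} (hF : ∀ j t, HasDerivAt (F j) (F (j + 1) t) t)
    (hpos : ∀ n, 0 < M n) (hconv : ∀ n, M (n + 1) ^ 2 ≤ M n * M (n + 2))
    (hM : ∀ j t, ‖F j t‖ ≤ M j) {N : ℕ} {x h : ℝ} (h0 : 0 ≤ h)
    (h1 : h ≤ Real.exp (-1) * (M N / M (N + 1)))
    (hx : ∀ j : ℕ, ‖F j x‖ ≤ Real.exp (j - (N + 1 : ℕ)) * M j) (j : ℕ) :
    ‖F j (x + h)‖ ≤ Real.exp (j - N) * M j := by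
  set r : ℝ := M (N + 1) / M N with hr
  have hr0 : 0 < r := div_pos (hpos _) (hpos _)
  set q : ℝ := Real.exp 1 * r with hq
  -- The derivatives of order at most `N + 1` grow at most like `exp (q * s)`; this is proved by
  -- integrating downwards from order `N + 1`, where it is the global bound `M (N + 1)`.
  have key : ∀ i j : ℕ, j + i = N + 1 → ∀ s ∈ Set.Icc (0 : ℝ) h,
      ‖F j (x + s)‖ ≤ Real.exp (j - (N + 1 : ℕ)) * M j * Real.exp (q * s) := by
    intro i
    induction i with
    | zero =>
      intro j hj s hs
      obtain rfl : j = N + 1 := by omega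
      have : 1 ≤ Real.exp (q * s) := Real.one_le_exp (by have := hs.1; positivity)
      simp only [sub_self, Real.exp_zero, one_mul]
      exact (hM _ _).trans (le_mul_of_one_le_right (hpos _).le this)
    | succ i ih =>
      intro j hj
      have hder : ∀ s, HasDerivAt (fun s => F j (x + s)) (F (j + 1) (x + s)) s := fun s =>
        (hF j (x + s)).comp_const_add x s
      have hB : ∀ s, HasDerivAt
          (fun s => Real.exp (j - (N + 1 : ℕ)) * M j * Real.exp (q * s))
          (Real.exp (j - (N + 1 : ℕ)) * M j * (Real.exp (q * s) * q)) s := fun s =>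
        (((hasDerivAt_id s).const_mul q).exp.const_mul _).congr_deriv (by simp)
      refine image_norm_le_of_norm_deriv_right_le_deriv_boundary
        (f' := fun s => F (j + 1) (x + s))
        (fun s _ => (hder s).continuousAt.continuousWithinAt)
        (fun s _ => (hder s).hasDerivWithinAt) ?_ hB ?_
      · simpa using hx j
      · intro s hs
        refine (ih (j + 1) (by omega) s ⟨hs.1, hs.2.le⟩).trans ?_
        have hmono : M (j + 1) ≤ r * M j := by
          have := ratio_monotone_of_logConvex hpos hconv (show j ≤ N by omega)
          exact (div_le_iff₀ (hpos j)).1 this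
        have he : Real.exp ((j + 1 : ℕ) - (N + 1 : ℕ)) =
            Real.exp (j - (N + 1 : ℕ)) * Real.exp 1 := by
          rw [← Real.exp_add]; push_cast; ring_nf
        rw [he, hq]
        calc _ ≤ Real.exp (j - (N + 1 : ℕ)) * Real.exp 1 * (r * M j) *
                Real.exp (Real.exp 1 * r * s) := by gcongr
          _ = _ := by ring
  rcases le_total j N with hj | hj
  · refine (key (N + 1 - j) j (by omega) h ⟨h0, le_rfl⟩).trans ?_
    have hqh : q * h ≤ 1 := by
      calc q * h ≤ q * (Real.exp (-1) * (M N / M (N + 1))) := by gcongr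
        _ = 1 := by
          have := (hpos N).ne'
          have := (hpos (N + 1)).ne'
          rw [hq, hr, Real.exp_neg]; field_simp
    have := hpos j
    calc _ ≤ Real.exp (j - (N + 1 : ℕ)) * M j * Real.exp 1 := by gcongr
      _ = Real.exp (j - (N + 1 : ℕ)) * Real.exp 1 * M j := by ring
      _ = _ := by rw [← Real.exp_add]; push_cast; ring_nf
  · refine (hM _ _).trans (le_mul_of_one_le_left (hpos _).le (Real.one_le_exp ?_))
    rw [sub_nonneg]; exact_mod_cast hj

/-- The quasi-analyticity half of the Denjoy–Carleman theorem: a smooth function on the line (given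
together with its derivatives `F j`) all of whose derivatives vanish at `0` vanishes to the right
of `0`, if its derivatives are bounded by a log-convex sequence with `∑ M n / M (n + 1) = ∞`. -/
theorem eq_zero_of_quasiAnalytic {E : Type*} [NormedAddCommGroup E] [NormedSpace ℝ E]
    {F : ℕ → ℝ → E} {M : ℕ → ℝ} (hF : ∀ j t, HasDerivAt (F j) (F (j + 1) t) t)
    (hpos : ∀ n, 0 < M n) (hconv : ∀ n, M (n + 1) ^ 2 ≤ M n * M (n + 2))
    (hM : ∀ j t, ‖F j t‖ ≤ M j) (hdiv : ¬ Summable fun n => M n / M (n + 1))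
    (hzero : ∀ j, F j 0 = 0) {t : ℝ} (ht : 0 ≤ t) : F 0 t = 0 := by
  set a : ℕ → ℝ := fun n => Real.exp (-1) * (M n / M (n + 1)) with ha
  have ha0 : ∀ n, 0 ≤ a n := fun n =>
    mul_nonneg (Real.exp_pos _).le (div_pos (hpos _) (hpos _)).le
  have hdiv' : ¬ Summable a := fun h => hdiv ((summable_mul_left_iff (Real.exp_ne_zero _)).1 h)
  -- With `K` steps of lengths `a (N + K - 1), …, a N` from `0`, the bound at level `N` is reached.
  have key : ∀ K N : ℕ, ∀ x, 0 ≤ x → x ≤ ∑ i ∈ Finset.range K, a (N + i) →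
      ∀ j : ℕ, ‖F j x‖ ≤ Real.exp (j - N) * M j := by
    intro K
    induction K with
    | zero =>
      intro N x hx hx' j
      have : x = 0 := le_antisymm (by simpa using hx') hx
      rw [this, hzero, norm_zero]
      exact mul_nonneg (Real.exp_pos _).le (hpos _).le
    | succ K ih =>
      intro N x hx hx' j
      have hx'' : max 0 (x - a N) ≤ ∑ i ∈ Finset.range K, a (N + 1 + i) := by
        refine max_le (Finset.sum_nonneg fun i _ => ha0 _) ?_
        rw [Finset.sum_range_succ'] at hx'
        simp only [add_zero] at hx'
        have : ∑ i ∈ Finset.range K, a (N + (i + 1)) = ∑ i ∈ Finset.range K, a (N + 1 + i) :=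
          Finset.sum_congr rfl fun i _ => by congr 1; omega
        linarith
      have hstep := ih (N + 1) _ (le_max_left _ _) hx''
      have := norm_iterate_le_of_step hF hpos hconv hM (N := N) (x := max 0 (x - a N))
        (h := x - max 0 (x - a N)) (sub_nonneg.2 (max_le hx (by linarith [ha0 N])))
        (by linarith [le_max_right 0 (x - a N)]) hstep j
      simpa using this
  have hall : ∀ N : ℕ, ‖F 0 t‖ ≤ Real.exp (-N) * M 0 := by
    intro N
    have hN : ¬ Summable fun i => a (N + i) := by
      simpa only [add_comm N] using fun h => hdiv' ((summable_nat_add_iff N).1 h)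
    have htend := (not_summable_iff_tendsto_nat_atTop_of_nonneg fun i => ha0 (N + i)).1 hN
    obtain ⟨K, hK⟩ := (htend.eventually_ge_atTop t).exists
    simpa using key K N t ht hK 0
  have hlim : Filter.Tendsto (fun N : ℕ => Real.exp (-N) * M 0) Filter.atTop (nhds 0) := by
    simpa using (Real.tendsto_exp_neg_atTop_nhds_zero.comp
      tendsto_natCast_atTop_atTop).mul_const (M 0)
  exact norm_le_zero_iff.1 (ge_of_tendsto' hlim hall)

/-! ### Carleman's inequality -/

theorem div_exp_one_le_factorial_rpow (n : ℕ) :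
    ((n : ℝ) + 1) / Real.exp 1 ≤ ((n + 1).factorial : ℝ) ^ (1 / ((n : ℝ) + 1)) := by
  have hn : (0 : ℝ) < (n : ℝ) + 1 := by positivity
  have h := Real.pow_div_factorial_le_exp (x := (n : ℝ) + 1) hn.le (n + 1)
  have hf : (0 : ℝ) < ((n + 1).factorial : ℝ) := by positivity
  rw [div_le_iff₀ hf, mul_comm, ← div_le_iff₀ (Real.exp_pos _)] at h
  have h2 : ((n : ℝ) + 1) / Real.exp 1 =
      ((((n : ℝ) + 1) ^ (n + 1)) / Real.exp ((n : ℝ) + 1)) ^ (1 / ((n : ℝ) + 1)) := by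
    have : Real.exp ((n : ℝ) + 1) = Real.exp 1 ^ (n + 1) := by
      rw [← Real.exp_nat_mul]; push_cast; ring_nf
    rw [this, ← div_pow, ← Real.rpow_natCast, ← Real.rpow_mul (by positivity)]
    push_cast
    rw [mul_one_div_cancel hn.ne', Real.rpow_one]
  rw [h2]
  exact Real.rpow_le_rpow (by positivity) h (by positivity)

theorem geom_mean_le_sum_div_sq {a : ℕ → ℝ} (ha : ∀ n, 0 ≤ a n) (n : ℕ) :
    (∏ k ∈ Finset.range (n + 1), a k) ^ (1 / ((n : ℝ) + 1)) ≤
      Real.exp 1 * ∑ k ∈ Finset.range (n + 1), (((n + 1 : ℕ) : ℝ) ^ 2)⁻¹ * ((k + 1) * a k) := by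
  have hn : (0 : ℝ) < (n : ℝ) + 1 := by positivity
  -- The weights `k + 1` in the inequality of the means give a total that can be summed over `n`.
  have h := Real.geom_mean_le_arith_mean (Finset.range (n + 1)) (fun _ => 1)
    (fun k => ((k : ℝ) + 1) * a k) (fun _ _ => zero_le_one) (by simp; positivity)
    (fun k _ => mul_nonneg (by positivity) (ha k))
  simp only [Real.rpow_one, Finset.sum_const, Finset.card_range, nsmul_eq_mul, mul_one, one_mul,
    Finset.prod_mul_distrib] at h
  have hfac : ∏ k ∈ Finset.range (n + 1), ((k : ℝ) + 1) = ((n + 1).factorial : ℝ) := by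
    rw [← Finset.prod_range_add_one_eq_factorial]; push_cast; rfl
  have hP : 0 ≤ ∏ k ∈ Finset.range (n + 1), a k := Finset.prod_nonneg fun k _ => ha k
  rw [hfac, Real.mul_rpow (by positivity) hP] at h
  push_cast at h
  rw [← one_div] at h
  have hG : 0 ≤ (∏ k ∈ Finset.range (n + 1), a k) ^ (1 / ((n : ℝ) + 1)) := Real.rpow_nonneg hP _
  have h3 := (mul_le_mul_of_nonneg_right (div_exp_one_le_factorial_rpow n) hG).trans h
  rw [← Finset.mul_sum]
  push_cast
  set S := ∑ k ∈ Finset.range (n + 1), ((k : ℝ) + 1) * a k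
  set G := (∏ k ∈ Finset.range (n + 1), a k) ^ (1 / ((n : ℝ) + 1))
  have he := Real.exp_pos 1
  rw [div_mul_eq_mul_div, div_le_div_iff₀ he hn] at h3
  rw [inv_mul_eq_div, mul_div_assoc', le_div_iff₀ (by positivity)]
  nlinarith

/-- A form of Carleman's inequality: `∑ (a 0 ⋯ a n) ^ (1 / (n + 1)) ≤ 2 e ∑ a n`. -/
theorem summable_geom_mean {a : ℕ → ℝ} (ha : ∀ n, 0 ≤ a n) (hs : Summable a) :
    Summable fun n : ℕ => (∏ k ∈ Finset.range (n + 1), a k) ^ (1 / ((n : ℝ) + 1)) := by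
  refine summable_of_sum_range_le (c := Real.exp 1 * (2 * ∑' k, a k))
    (fun n => Real.rpow_nonneg (Finset.prod_nonneg fun k _ => ha k) _) fun N => ?_
  calc _ ≤ ∑ n ∈ Finset.range N, Real.exp 1 *
        ∑ k ∈ Finset.range (n + 1), (((n + 1 : ℕ) : ℝ) ^ 2)⁻¹ * ((k + 1) * a k) :=
        Finset.sum_le_sum fun n _ => geom_mean_le_sum_div_sq ha n
    _ = Real.exp 1 * ∑ k ∈ Finset.range N, ∑ n ∈ Finset.Ico k N,
        (((n + 1 : ℕ) : ℝ) ^ 2)⁻¹ * ((k + 1) * a k) := by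
        rw [← Finset.mul_sum]
        congr 1
        refine Finset.sum_comm' fun n k => ?_
        simp only [Finset.mem_range, Finset.mem_Ico]
        omega
    _ ≤ Real.exp 1 * ∑ k ∈ Finset.range N, 2 * a k := by
        gcongr with k hk
        rw [← Finset.sum_mul]
        have h : ∑ n ∈ Finset.Ico k N, (((n + 1 : ℕ) : ℝ) ^ 2)⁻¹ ≤ 2 / ((k : ℝ) + 1) := by
          refine le_trans (le_of_eq ?_) (sum_Ioo_inv_sq_le (α := ℝ) k (N + 1))
          rw [Finset.sum_Ico_add' (fun n : ℕ => ((n : ℝ) ^ 2)⁻¹) k N 1]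
          congr 1
        have hk : (0 : ℝ) < (k : ℝ) + 1 := by positivity
        calc _ ≤ 2 / ((k : ℝ) + 1) * (((k : ℝ) + 1) * a k) :=
              mul_le_mul_of_nonneg_right h (mul_nonneg hk.le (ha k))
          _ = 2 * a k := by field_simp
    _ ≤ _ := by
        rw [← Finset.mul_sum]
        have := hs.sum_le_tsum (Finset.range N) fun k _ => ha k
        gcongr

theorem not_summable_ratio_of_not_summable_root {M : ℕ → ℝ} (hpos : ∀ n, 0 < M n)
    (hdiv : ¬ Summable fun n : ℕ => (M 0 / M (2 * (n + 1))) ^ (1 / (2 * ((n : ℝ) + 1)))) :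
    ¬ Summable fun n => M n / M (n + 1) := by
  intro hs
  have h := summable_geom_mean (fun n => (div_pos (hpos n) (hpos (n + 1))).le) hs
  have hprod : ∀ n, ∏ k ∈ Finset.range n, M k / M (k + 1) = M 0 / M n := by
    intro n
    induction n with
    | zero => simp [(hpos 0).ne']
    | succ n ih => rw [Finset.prod_range_succ, ih, div_mul_div_cancel₀ (hpos n).ne']
  simp only [hprod] at h
  have hinj : Function.Injective fun n : ℕ => 2 * n + 1 := fun m n h => by
    simp only at h; omega
  refine hdiv ((h.comp_injective hinj).congr fun n => ?_)
  simp only [Function.comp]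
  push_cast
  ring_nf

/-! ### Determinacy of the Hamburger moment problem -/

theorem sq_integral_abs_pow_le {ρ : Measure ℝ} (hρ : ∀ n : ℕ, Integrable (fun x => |x| ^ n) ρ)
    (n : ℕ) :
    (∫ x, |x| ^ (n + 1) ∂ρ) ^ 2 ≤ (∫ x, |x| ^ n ∂ρ) * ∫ x, |x| ^ (n + 2) ∂ρ := by
  have h : ∀ t : ℝ, 0 ≤ (∫ x, |x| ^ (n + 2) ∂ρ) * (t * t) +
      (-2 * ∫ x, |x| ^ (n + 1) ∂ρ) * t + ∫ x, |x| ^ n ∂ρ := by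
    intro t
    have h0 : 0 ≤ ∫ x, |x| ^ n * (t * |x| - 1) ^ 2 ∂ρ :=
      integral_nonneg fun x => by positivity
    have h1 : ∀ x : ℝ, |x| ^ n * (t * |x| - 1) ^ 2 =
        (t * t) * |x| ^ (n + 2) + (-2 * t) * |x| ^ (n + 1) + |x| ^ n := fun x => by ring
    simp only [h1] at h0
    have hi := (hρ (n + 2)).const_mul (t * t)
    have hi' := (hρ (n + 1)).const_mul (-2 * t)
    have hi'' : Integrable (fun x => t * t * |x| ^ (n + 2) + -2 * t * |x| ^ (n + 1)) ρ :=
      hi.add hi'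
    rw [integral_add hi'' (hρ _),
      integral_add hi hi', integral_const_mul,
      integral_const_mul] at h0
    linarith
  have := discrim_le_zero h
  rw [discrim] at this
  nlinarith

theorem memLp_id_of_integrable_abs_pow {ρ : Measure ℝ} [IsFiniteMeasure ρ]
    (hρ : ∀ n : ℕ, Integrable (fun x => |x| ^ n) ρ) (n : ℕ) : MemLp id n ρ := by
  rcases eq_or_ne n 0 with rfl | hn
  · simpa using aestronglyMeasurable_id
  · refine (integrable_norm_rpow_iff aestronglyMeasurable_id (by exact_mod_cast hn)
      (ENNReal.natCast_ne_top n)).1 ?_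
    simpa using hρ n

theorem eq_dirac_zero_of_integral_sq_eq_zero {ρ : Measure ℝ} [IsProbabilityMeasure ρ]
    (hi : Integrable (fun x => x ^ 2) ρ) (h : ∫ x, x ^ 2 ∂ρ = 0) : ρ = Measure.dirac 0 := by
  have h1 := (integral_eq_zero_iff_of_nonneg (fun x => sq_nonneg x) hi).1 h
  have h2 : (id : ℝ → ℝ) =ᵐ[ρ] fun _ => 0 := h1.mono fun x hx => by simpa using hx
  have h3 : ρ.map id = ρ.map fun _ => (0 : ℝ) := Measure.map_congr h2
  rwa [Measure.map_id, Measure.map_const, measure_univ, one_smul] at h3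

/-- **Carleman's theorem**: a probability measure on the line whose even moments satisfy Carleman's
condition is determined by its moments. -/
theorem measure_eq_of_carleman {μ ν : Measure ℝ} [IsProbabilityMeasure μ] [IsProbabilityMeasure ν]
    (hμ : ∀ n : ℕ, Integrable (fun x => |x| ^ n) μ) (hν : ∀ n : ℕ, Integrable (fun x => |x| ^ n) ν)
    (hmom : ∀ n : ℕ, ∫ x, x ^ n ∂μ = ∫ x, x ^ n ∂ν) (hC : CarlemanCondition id μ) : μ = ν := by
  have heven : ∀ n : ℕ, ∀ x : ℝ, |x| ^ (2 * (n + 1)) = x ^ (2 * (n + 1)) := fun n x =>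
    (even_two_mul _).pow_abs x
  have h2μ : Integrable (fun x : ℝ => x ^ 2) μ := by simpa using hμ 2
  have h2ν : Integrable (fun x : ℝ => x ^ 2) ν := by simpa using hν 2
  by_cases hdeg : ∫ x, x ^ 2 ∂μ = 0
  · rw [eq_dirac_zero_of_integral_sq_eq_zero h2μ hdeg,
      eq_dirac_zero_of_integral_sq_eq_zero h2ν (hmom 2 ▸ hdeg)]
  have hLμ := memLp_id_of_integrable_abs_pow hμ
  have hLν := memLp_id_of_integrable_abs_pow hν
  -- The absolute moments of `μ + ν` are log-convex and dominate the derivatives of the difference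
  -- of the characteristic functions; at even orders they are twice the moments of `μ`.
  set M : ℕ → ℝ := fun n => ∫ x, |x| ^ n ∂(μ + ν) with hMdef
  have hsum : ∀ n : ℕ, Integrable (fun x => |x| ^ n) (μ + ν) := fun n => (hμ n).add_measure (hν n)
  have hMadd : ∀ n, M n = ∫ x, |x| ^ n ∂μ + ∫ x, |x| ^ n ∂ν := fun n =>
    integral_add_measure (hμ n) (hν n)
  have hposμ : ∀ n : ℕ, 0 < ∫ x, |x| ^ n ∂μ := by
    intro n
    refine lt_of_le_of_ne (integral_nonneg fun x => by positivity) fun h => hdeg ?_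
    have h1 := (integral_eq_zero_iff_of_nonneg (fun x => by positivity) (hμ n)).1 h.symm
    refine integral_eq_zero_of_ae (h1.mono fun x hx => ?_)
    have hx0 : |x| = 0 := eq_zero_of_pow_eq_zero hx
    simpa using hx0
  have hpos : ∀ n, 0 < M n := fun n => by
    rw [hMadd]
    exact add_pos_of_pos_of_nonneg (hposμ n) (integral_nonneg fun x => by positivity)
  have hdiv : ¬ Summable fun n => M n / M (n + 1) := by
    refine not_summable_ratio_of_not_summable_root hpos fun hs => hs.tsum_ofReal_ne_top ?_
    rw [CarlemanCondition] at hC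
    rw [← hC]
    congr 1
    ext n
    have hM0 : M 0 = 2 := by rw [hMadd]; simp; norm_num
    have hM2 : M (2 * (n + 1)) = 2 * ∫ x, |x| ^ (2 * (n + 1)) ∂μ := by
      rw [hMadd]; simp only [heven]; rw [hmom]; ring
    rw [hM0, hM2, ← ofReal_integral_eq_lintegral_ofReal (by simpa only [id] using hμ _)
      (Filter.Eventually.of_forall fun x => by positivity),
      ENNReal.ofReal_rpow_of_pos (by simpa only [id] using hposμ _),
      Real.rpow_neg (integral_nonneg fun x => by positivity),
      ← Real.inv_rpow (integral_nonneg fun x => by positivity)]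
    congr 2
    have := (hposμ (2 * (n + 1))).ne'
    simp only [id]
    field_simp
  set F : ℕ → ℝ → ℂ := fun j t => iteratedDeriv j (charFun μ) t - iteratedDeriv j (charFun ν) t
    with hFdef
  have hderiv : ∀ (ρ : Measure ℝ) [IsFiniteMeasure ρ], (∀ n : ℕ, MemLp id n ρ) → ∀ (j : ℕ) (t : ℝ),
      HasDerivAt (iteratedDeriv j (charFun ρ)) (iteratedDeriv (j + 1) (charFun ρ) t) t := by
    intro ρ _ hρ j t
    have hd : DifferentiableAt ℝ (iteratedDeriv j (charFun ρ)) t :=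
      (contDiff_charFun (hρ (j + 1))).differentiable_iteratedDeriv j
        (by exact_mod_cast j.lt_succ_self) t
    rw [iteratedDeriv_succ]
    exact hd.hasDerivAt
  have hbound : ∀ (ρ : Measure ℝ) [IsFiniteMeasure ρ], (∀ n : ℕ, MemLp id n ρ) → ∀ (j : ℕ) (t : ℝ),
      ‖iteratedDeriv j (charFun ρ) t‖ ≤ ∫ x, |x| ^ j ∂ρ := by
    intro ρ _ hρ j t
    rw [iteratedDeriv_charFun (hρ j), norm_mul, norm_pow, Complex.norm_I, one_pow, one_mul]
    refine (norm_integral_le_integral_norm _).trans (le_of_eq (integral_congr_ae ?_))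
    refine Filter.Eventually.of_forall fun x => ?_
    simp only [norm_mul, norm_pow, Complex.norm_real, Real.norm_eq_abs]
    rw [← Complex.ofReal_mul, Complex.norm_exp_ofReal_mul_I, mul_one]
  have hF : ∀ j t, HasDerivAt (F j) (F (j + 1) t) t := fun j t =>
    (hderiv μ hLμ j t).sub (hderiv ν hLν j t)
  have hM : ∀ j t, ‖F j t‖ ≤ M j := fun j t => by
    rw [hMadd]
    exact (norm_sub_le _ _).trans (add_le_add (hbound μ hLμ j t) (hbound ν hLν j t))
  have hzero : ∀ j, F j 0 = 0 := fun j => by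
    simp only [hFdef, iteratedDeriv_charFun_zero (hLμ j), iteratedDeriv_charFun_zero (hLν j), hmom,
      sub_self]
  have hnonneg : ∀ t : ℝ, 0 ≤ t → charFun μ t = charFun ν t := fun t ht => by
    have := eq_zero_of_quasiAnalytic hF hpos (sq_integral_abs_pow_le hsum) hM hdiv hzero ht
    simpa [hFdef, sub_eq_zero] using this
  refine Measure.ext_of_charFun (funext fun t => ?_)
  rcases le_total 0 t with ht | ht
  · exact hnonneg t ht
  · have := hnonneg (-t) (by linarith)
    rw [charFun_neg, charFun_neg] at this
    exact star_injective this

theorem CarlemanCondition.map_of_abs_le {Ω : Type*} [MeasurableSpace Ω] {μ : Measure Ω}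
    {Z W : Ω → ℝ} {c : ℝ} (hc : 0 < c) (hW : Measurable W)
    (hZint : ∀ n : ℕ, 1 ≤ n → Integrable (fun ω => |Z ω| ^ n) μ)
    (hle : ∀ ω, |W ω| ≤ c * |Z ω|) (hZ : CarlemanCondition Z μ) :
    CarlemanCondition id (μ.map W) := by
  rw [CarlemanCondition] at hZ ⊢
  have hc' : (ENNReal.ofReal c)⁻¹ ≠ 0 := by simp
  have h : (ENNReal.ofReal c)⁻¹ * ∑' n : ℕ,
      (∫⁻ ω, ENNReal.ofReal (|Z ω| ^ (2 * (n + 1))) ∂μ) ^ (-(1 / (2 * ((n : ℝ) + 1)))) = ∞ := by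
    rw [hZ, ENNReal.mul_top hc']
  rw [← ENNReal.tsum_mul_left] at h
  refine top_le_iff.1 (h ▸ ENNReal.tsum_le_tsum fun n => ?_)
  rw [lintegral_map (by fun_prop) hW]
  simp only [id]
  set A := ∫⁻ ω, ENNReal.ofReal (|Z ω| ^ (2 * (n + 1))) ∂μ with hA
  have hAtop : A ≠ ⊤ := (hZint (2 * (n + 1)) (by omega)).lintegral_lt_top.ne
  have h1 : ∫⁻ ω, ENNReal.ofReal (|W ω| ^ (2 * (n + 1))) ∂μ ≤
      ENNReal.ofReal c ^ (2 * (n + 1)) * A := by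
    rw [hA, ← lintegral_const_mul' _ _ (by finiteness)]
    refine lintegral_mono fun ω => ?_
    rw [← ENNReal.ofReal_pow hc.le, ← ENNReal.ofReal_mul (by positivity), ← mul_pow]
    exact ENNReal.ofReal_le_ofReal (pow_le_pow_left₀ (abs_nonneg _) (hle ω) _)
  have hn : (0 : ℝ) < (n : ℝ) + 1 := by positivity
  calc (ENNReal.ofReal c)⁻¹ * A ^ (-(1 / (2 * ((n : ℝ) + 1))))
      = (ENNReal.ofReal c ^ (2 * (n + 1)) * A) ^ (-(1 / (2 * ((n : ℝ) + 1)))) := by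
        rw [ENNReal.mul_rpow_of_ne_top (by finiteness) hAtop, ← ENNReal.rpow_natCast,
          ← ENNReal.rpow_mul]
        congr 1
        push_cast
        rw [show 2 * ((n : ℝ) + 1) * -(1 / (2 * ((n : ℝ) + 1))) = -1 by field_simp,
          ENNReal.rpow_neg_one]
    _ ≤ _ := by
        rw [ENNReal.rpow_neg, ENNReal.rpow_neg, ENNReal.inv_le_inv]
        exact ENNReal.rpow_le_rpow h1 (by positivity)

/-! ### Tensor powers and their moments -/

section Continuous

variable {B : Type*} [NormedAddCommGroup B] [TopologicalSpace.SeparableSpace B]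
  [MeasurableSpace B] [BorelSpace B] {Ω Ω' : Type*} [MeasurableSpace Ω] [MeasurableSpace Ω']
  {μ : Measure Ω} {ν : Measure Ω'} {X : Ω → B} {Y : Ω' → B}

theorem Measurable.integrable_comp_of_norm_le_pow {G : Type*} [NormedAddCommGroup G] {f : B → G}
    (hf : Continuous f) {k : ℕ} (hle : ∀ x, ‖f x‖ ≤ ‖x‖ ^ k) (hX : Measurable X)
    (hint : Integrable (fun ω => ‖X ω‖ ^ k) μ) : Integrable (fun ω => f (X ω)) μ := by
  have : SecondCountableTopology B := UniformSpace.secondCountable_of_separable B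
  refine hint.mono' (hf.comp_stronglyMeasurable hX.stronglyMeasurable).aestronglyMeasurable ?_
  exact Filter.Eventually.of_forall fun ω => hle _

theorem ProbabilityTheory.IdentDistrib.integral_comp_continuous_eq {G : Type*}
    [NormedAddCommGroup G] [NormedSpace ℝ G] {f : B → G} (hf : Continuous f)
    (h : IdentDistrib X Y μ ν) : ∫ ω, f (X ω) ∂μ = ∫ ω, f (Y ω) ∂ν := by
  have : SecondCountableTopology B := UniformSpace.secondCountable_of_separable B
  rw [← integral_map h.aemeasurable_fst hf.aestronglyMeasurable, h.map_eq,
    integral_map h.aemeasurable_snd hf.aestronglyMeasurable]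

end Continuous

section Tensor

variable {B : Type*} [NormedAddCommGroup B] [NormedSpace ℝ B]

theorem continuous_projPow (k : ℕ) : Continuous (projPow (B := B) k) := by
  have h : Continuous fun x : B => PiTensorProduct.tprodL ℝ (fun _ : Fin k => x) :=
    (PiTensorProduct.tprodL ℝ).cont.comp (continuous_pi fun _ => continuous_id)
  have h' := (UniformSpace.Completion.continuous_coe (⨂[ℝ] _ : Fin k, B)).comp h
  refine h'.congr fun x => ?_
  simp [projPow]

theorem norm_projPow_le (k : ℕ) (x : B) : ‖projPow k x‖ ≤ ‖x‖ ^ k := by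
  rw [projPow, UniformSpace.Completion.norm_coe]
  simpa using PiTensorProduct.projectiveSeminorm_tprod_le (𝕜 := ℝ) fun _ : Fin k => x

theorem norm_injPow_le (k : ℕ) (x : B) : ‖injPow k x‖ ≤ ‖x‖ ^ k := by
  change ‖elemForm k (fun _ => x)‖ ≤ ‖x‖ ^ k
  refine ContinuousMultilinearMap.opNorm_le_bound (by positivity) fun φ => ?_
  rw [elemForm_apply, norm_prod, mul_comm]
  calc ∏ i, ‖φ i x‖ ≤ ∏ i, (‖φ i‖ * ‖x‖) :=
        Finset.prod_le_prod (fun _ _ => norm_nonneg _) fun i _ => (φ i).le_opNorm x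
    _ = (∏ i, ‖φ i‖) * ‖x‖ ^ k := by simp [Finset.prod_mul_distrib]

theorem continuous_injPow (k : ℕ) : Continuous (injPow (B := B) k) := by
  have h : Continuous fun x : B => elemForm k (fun _ : Fin k => x) := by
    have h1 : Continuous fun x : B => fun _ : Fin k => NormedSpace.inclusionInDoubleDual ℝ B x := by
      fun_prop
    exact ((ContinuousMultilinearMap.compContinuousLinearMapContinuousMultilinear ℝ
      (fun _ : Fin k => StrongDual ℝ B) (fun _ : Fin k => ℝ) ℝ).cont.comp h1).clm_apply
        continuous_const
  exact Continuous.subtype_mk h _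

/-- The bounded functional `φ ⊗ ⋯ ⊗ φ` on the projective tensor power. -/
noncomputable def projDualPow (k : ℕ) (φ : StrongDual ℝ B) : ProjTensorPower k B →L[ℝ] ℝ :=
  (PiTensorProduct.liftIsometry ℝ (fun _ : Fin k => B) ℝ
    ((ContinuousMultilinearMap.mkPiAlgebra ℝ (Fin k) ℝ).compContinuousLinearMap
      fun _ => φ)).extend UniformSpace.Completion.toComplL

theorem projDualPow_projPow (k : ℕ) (φ : StrongDual ℝ B) (x : B) :
    projDualPow k φ (projPow k x) = φ x ^ k := by
  have h := ContinuousLinearMap.extend_eq (PiTensorProduct.liftIsometry ℝ (fun _ : Fin k => B) ℝ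
    ((ContinuousMultilinearMap.mkPiAlgebra ℝ (Fin k) ℝ).compContinuousLinearMap
      fun _ => φ)) (e := UniformSpace.Completion.toComplL (𝕜 := ℝ))
    UniformSpace.Completion.denseRange_coe
    (UniformSpace.Completion.isUniformInducing_coe _) (⨂ₜ[ℝ] _ : Fin k, x)
  refine h.trans ?_
  simp

/-- Evaluation at `(φ, …, φ)`, the functional `φ ⊗ ⋯ ⊗ φ` on the injective tensor power. -/
noncomputable def injDualPow (k : ℕ) (φ : StrongDual ℝ B) : InjTensorPower k B →L[ℝ] ℝ :=
  (ContinuousMultilinearMap.apply ℝ (fun _ : Fin k => StrongDual ℝ B) ℝ (fun _ => φ)).comp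
    (injSubmodule k B).subtypeL

theorem injDualPow_injPow (k : ℕ) (φ : StrongDual ℝ B) (x : B) :
    injDualPow k φ (injPow k x) = φ x ^ k := by
  change elemForm k (fun _ => x) (fun _ => φ) = φ x ^ k
  simp [elemForm_apply]

variable [MeasurableSpace B] [BorelSpace B]
  {Ω Ω' : Type*} [MeasurableSpace Ω] [MeasurableSpace Ω'] {μ : Measure Ω} {ν : Measure Ω'}
  {X : Ω → B} {Y : Ω' → B}

theorem integrable_abs_pow_map_dual [IsFiniteMeasure μ] (hX : Measurable X)
    (hXmom : ∀ k : ℕ, 1 ≤ k → Integrable (fun ω => ‖X ω‖ ^ k) μ) (φ : StrongDual ℝ B) (n : ℕ) :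
    Integrable (fun x => |x| ^ n) (μ.map fun ω => φ (X ω)) := by
  have hm : Measurable fun ω => φ (X ω) := φ.continuous.measurable.comp hX
  rw [integrable_map_measure (by fun_prop) hm.aemeasurable]
  rcases Nat.eq_zero_or_pos n with rfl | hn
  · simp [Function.comp_def]
  · have hpow : Measurable fun x : ℝ => |x| ^ n := by fun_prop
    refine ((hXmom n hn).const_mul (‖φ‖ ^ n)).mono' (hpow.comp hm).aestronglyMeasurable ?_
    refine Filter.Eventually.of_forall fun ω => ?_
    simp only [Function.comp, norm_pow, norm_abs_eq_norm, ← mul_pow]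
    exact pow_le_pow_left₀ (norm_nonneg _) (φ.le_opNorm _) n

/-- Under Carleman's condition on `‖X‖`, the scalar moments of `φ ∘ X` determine its law. -/
theorem identDistrib_dual_of_moments_eq [IsProbabilityMeasure μ] [IsProbabilityMeasure ν]
    (hX : Measurable X) (hY : Measurable Y)
    (hXmom : ∀ k : ℕ, 1 ≤ k → Integrable (fun ω => ‖X ω‖ ^ k) μ)
    (hYmom : ∀ k : ℕ, 1 ≤ k → Integrable (fun ω => ‖Y ω‖ ^ k) ν)
    (hC : CarlemanCondition (fun ω => ‖X ω‖) μ) (φ : StrongDual ℝ B)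
    (hmom : ∀ k : ℕ, 1 ≤ k → ∫ ω, φ (X ω) ^ k ∂μ = ∫ ω, φ (Y ω) ^ k ∂ν) :
    IdentDistrib (fun ω => φ (X ω)) (fun ω => φ (Y ω)) μ ν := by
  have hφX : Measurable fun ω => φ (X ω) := φ.continuous.measurable.comp hX
  have hφY : Measurable fun ω => φ (Y ω) := φ.continuous.measurable.comp hY
  refine ⟨hφX.aemeasurable, hφY.aemeasurable, ?_⟩
  have := Measure.isProbabilityMeasure_map (μ := μ) hφX.aemeasurable
  have := Measure.isProbabilityMeasure_map (μ := ν) hφY.aemeasurable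
  refine measure_eq_of_carleman (integrable_abs_pow_map_dual hX hXmom φ)
    (integrable_abs_pow_map_dual hY hYmom φ) (fun n => ?_) ?_
  · rw [integral_map hφX.aemeasurable (by fun_prop), integral_map hφY.aemeasurable (by fun_prop)]
    rcases Nat.eq_zero_or_pos n with rfl | hn
    · simp
    · exact hmom n hn
  · -- The constant is `‖φ‖ + 1` because it has to be positive.
    refine hC.map_of_abs_le (c := ‖φ‖ + 1) (by positivity) hφX (by simpa using hXmom) fun ω => ?_
    rw [abs_norm, ← Real.norm_eq_abs]
    exact (φ.le_opNorm _).trans (by gcongr; linarith)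

/-- The Cramér–Wold device: a Borel law on a separable Banach space is determined by the laws of
its images under bounded functionals. -/
theorem identDistrib_of_forall_dual [CompleteSpace B]
    [TopologicalSpace.SeparableSpace B] [IsFiniteMeasure μ] [IsFiniteMeasure ν]
    (hX : Measurable X) (hY : Measurable Y)
    (h : ∀ φ : StrongDual ℝ B, IdentDistrib (fun ω => φ (X ω)) (fun ω => φ (Y ω)) μ ν) :
    IdentDistrib X Y μ ν := by
  have : SecondCountableTopology B := UniformSpace.secondCountable_of_separable B
  refine ⟨hX.aemeasurable, hY.aemeasurable, Measure.ext_of_charFunDual (funext fun φ => ?_)⟩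
  rw [charFunDual_eq_charFun_map_one, charFunDual_eq_charFun_map_one,
    Measure.map_map φ.continuous.measurable hX, Measure.map_map φ.continuous.measurable hY]
  exact congrArg (fun ρ => charFun ρ 1) (h φ).map_eq

end Tensor

theorem theorem15p3 {B : Type*} [NormedAddCommGroup B] [NormedSpace ℝ B] [CompleteSpace B]
    [TopologicalSpace.SeparableSpace B] [MeasurableSpace B] [BorelSpace B]
    {Ω Ω' : Type*} [MeasurableSpace Ω] [MeasurableSpace Ω']
    (μ : Measure Ω) [IsProbabilityMeasure μ] (ν : Measure Ω') [IsProbabilityMeasure ν]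
    (X : Ω → B) (Y : Ω' → B) (hX : Measurable X) (hY : Measurable Y)
    (hXmom : ∀ k : ℕ, 1 ≤ k → Integrable (fun ω => ‖X ω‖ ^ k) μ)
    (hYmom : ∀ k : ℕ, 1 ≤ k → Integrable (fun ω => ‖Y ω‖ ^ k) ν)
    (hCarleman : CarlemanCondition (fun ω => ‖X ω‖) μ) :
    (∀ k : ℕ, 1 ≤ k →
      Integrable (fun ω => projPow k (X ω)) μ ∧ Integrable (fun ω => projPow k (Y ω)) ν ∧
      Integrable (fun ω => injPow k (X ω)) μ ∧ Integrable (fun ω => injPow k (Y ω)) ν) ∧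
    [IdentDistrib X Y μ ν,
      ∀ k : ℕ, 1 ≤ k → projMoment k X μ = projMoment k Y ν,
      ∀ k : ℕ, 1 ≤ k → injMoment k X μ = injMoment k Y ν,
      ∀ φ : StrongDual ℝ B, IdentDistrib (fun ω => φ (X ω)) (fun ω => φ (Y ω)) μ ν].TFAE := by
  have hint : ∀ k : ℕ, 1 ≤ k →
      Integrable (fun ω => projPow k (X ω)) μ ∧ Integrable (fun ω => projPow k (Y ω)) ν ∧
      Integrable (fun ω => injPow k (X ω)) μ ∧ Integrable (fun ω => injPow k (Y ω)) ν :=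
    fun k hk =>
      ⟨hX.integrable_comp_of_norm_le_pow (continuous_projPow k) (norm_projPow_le k) (hXmom k hk),
       hY.integrable_comp_of_norm_le_pow (continuous_projPow k) (norm_projPow_le k) (hYmom k hk),
       hX.integrable_comp_of_norm_le_pow (continuous_injPow k) (norm_injPow_le k) (hXmom k hk),
       hY.integrable_comp_of_norm_le_pow (continuous_injPow k) (norm_injPow_le k) (hYmom k hk)⟩
  refine ⟨hint, ?_⟩
  tfae_have 1 → 2 := fun h k _ => h.integral_comp_continuous_eq (continuous_projPow k)
  tfae_have 1 → 3 := fun h k _ => h.integral_comp_continuous_eq (continuous_injPow k)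
  tfae_have 2 → 4 := fun h φ =>
    identDistrib_dual_of_moments_eq hX hY hXmom hYmom hCarleman φ fun k hk => by
      have h1 := congrArg (projDualPow k φ) (h k hk)
      rw [projMoment, projMoment, ← ContinuousLinearMap.integral_comp_comm _ (hint k hk).1,
        ← ContinuousLinearMap.integral_comp_comm _ (hint k hk).2.1] at h1
      simpa only [projDualPow_projPow] using h1
  tfae_have 3 → 4 := fun h φ =>
    identDistrib_dual_of_moments_eq hX hY hXmom hYmom hCarleman φ fun k hk => by
      have h1 := congrArg (injDualPow k φ) (h k hk)
      rw [injMoment, injMoment, ← ContinuousLinearMap.integral_comp_comm _ (hint k hk).2.2.1,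
        ← ContinuousLinearMap.integral_comp_comm _ (hint k hk).2.2.2] at h1
      simpa only [injDualPow_injPow] using h1
  tfae_have 4 → 1 := identDistrib_of_forall_dual hX hY
  tfae_finish
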